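/- Consider $N$ wireless channels in slotted time $t=1,2,3,\dots$. The state of channel $i$ is a two-state Markov chain on $\{G,B\}$ with transition probability $p_i\in[0,1]$ from $G$ to $B$ and $q_i\in[0,1]$ from $B$ to $G$, where $0<p_i+q_i<2$, and with an arbitrary initial distribution; the $N$ chains are independent of each other (Gilbert-Elliott channels). Let $X_i(t)=1$ if channel $i$ is in state $G$ (ON) at time $t$ and $X_i(t)=0$ otherwise, and for $S\subseteq\{1,\dots,N\}$ let $X_S(t)=\max_{i\in S}X_i(t)$ (with $X_\emptyset(t)=0$). Put $$\pi_S=\prod_{i\in S}\frac{p_i}{p_i+q_i},\qquad G_i(k)=\frac{p_i}{p_i+q_i}+\frac{q_i}{p_i+q_i}(1-p_i-q_i)^{k-1}\quad(k\ge 1).$$ Then for every $S\subseteq\{1,\dots,N\}$: 1. The mean of $X_S$ exists and is given by $$m_S:=\lim_{T\to\infty}\frac1T\sum_{t=1}^T X_S(t)=1-\pi_S\quad\text{almost surely}.$$ 2. As $T\to\infty$, $\dfrac{\sum_{t=1}^T X_S(t)-T m_S}{\sqrt T}$ converges in distribution to a centred (possibly degenerate) Gaussian random variable $W_S$, and the temporal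 variance $v_S^2:=E[W_S^2]$ is given by $$v_S^2=2\sum_{k=1}^\infty\Big(\prod_{i\in S}G_i(k+1)-\pi_S\Big)\pi_S+\pi_S-\pi_S^2,$$ where the series converges absolutely. -/

import Mathlib

open MeasureTheory ProbabilityTheory Filter Topology
open scoped NNReal

/-- A discrete-time Markov chain `C 0, C 1, C 2, …` with transition probabilities `P a b`
(from `a` to `b`) and arbitrary initial law, for a countable state space. The Markov property is
written multiplicatively, so that histories of probability zero impose nothing. -/
structure IsMarkovChain {Ω α : Type*} [MeasurableSpace Ω] [MeasurableSpace α]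
    (μ : Measure Ω) (P : α → α → ℝ) (C : ℕ → Ω → α) : Prop where
  measurable : ∀ t, Measurable (C t)
  step : ∀ (t : ℕ) (a : ℕ → α),
    μ.real {ω | ∀ s ≤ t + 1, C s ω = a s} =
      μ.real {ω | ∀ s ≤ t, C s ω = a s} * P (a t) (a (t + 1))

/-- Transition probabilities of a Gilbert-Elliott channel: `true` is the good (ON) state,
`false` the bad (OFF) state, `p` is the probability of good to bad, `q` that of bad to good. -/
def gilbertElliott (p q : ℝ) : Bool → Bool → ℝ
  | true, false => p
  | true, true => 1 - p
  | false, true => q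
  | false, false => 1 - q

/-- `X_S(t) = max {X_i(t) | i ∈ S}`, where `X_i(t) ∈ {0, 1}` indicates that channel `i` is ON
(and `X_S(t) = 0` for empty `S`). -/
def onIndicator {Ω ι : Type*} (C : ι → ℕ → Ω → Bool) (S : Finset ι) (t : ℕ) (ω : Ω) : ℝ :=
  ((S.sup fun i => (C i t ω).toNat : ℕ) : ℝ)

/-- `m` is the mean of the process `X`: the time average over the first `T` slots converges
almost surely to `m`. The slots are `0, 1, 2, …`, so the first `T` of them are `range T`. -/
def HasTemporalMean {Ω : Type*} [MeasurableSpace Ω] (μ : Measure Ω) (X : ℕ → Ω → ℝ)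
    (m : ℝ) : Prop :=
  ∀ᵐ ω ∂μ, Tendsto (fun T : ℕ => (∑ t ∈ Finset.range T, X t ω) / (T : ℝ)) atTop (𝓝 m)

/-- `v` is the temporal variance of the process `X`: `X` has a mean `m`, the centred and scaled sums
`(∑_{t < T} X t - T m) / √T` converge in distribution to a centred (possibly degenerate) Gaussian
random variable, and `v` is the second moment of this limit. -/
def HasTemporalVariance {Ω : Type*} [MeasurableSpace Ω] (μ : Measure Ω) [IsProbabilityMeasure μ]
    (X : ℕ → Ω → ℝ) (v : ℝ) : Prop :=
  ∃ m : ℝ, HasTemporalMean μ X m ∧ ∃ s : ℝ≥0,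
    TendstoInDistribution
      (fun (T : ℕ) ω => (∑ t ∈ Finset.range T, X t ω - (T : ℝ) * m) / √(T : ℝ))
      atTop (id : ℝ → ℝ) (fun _ => μ) (gaussianReal 0 s) ∧
    ∫ x, x ^ 2 ∂(gaussianReal 0 s) = v

/-- `G(k) = p / (p + q) + q / (p + q) * (1 - p - q) ^ (k - 1)`, for `k ≥ 1`. -/
noncomputable def geG (p q : ℝ) (k : ℕ) : ℝ :=
  p / (p + q) + q / (p + q) * (1 - p - q) ^ (k - 1)

/-!
The complement of `X_S` is the indicator that the joint chain `Z = (C_i)_{i ∈ S}` sits in the single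
state "all OFF". By independence `Z` is a Markov chain, and every power of its transition matrix has
as entries the products of the entries of the same power of the channel matrices; for one channel
the powers converge geometrically, with ratio `1 - p - q`. Hence the joint chain is summably ergodic (`IsSummablyErgodic.pi`), and the claim
is an instance of limit theorems for such chains, with `Pᵏ(OFF, OFF) = ∏ G_i(k + 1)`.

These limit theorems rest on the Poisson equation: for a centred function `g` the potential
`u = ∑ₖ Pᵏ g` satisfies `u - P u = g`, so `∑_{t < n} g(Z_t)` is the martingale
`∑ (u(Z_{t+1}) - (P u)(Z_t))` plus a bounded boundary term. A bounded-increment martingale has fourth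
moment `O(n²)`, which gives the strong law. The central limit theorem is McLeish's argument: with
increments `D_t`, the product `∏ (1 + i θ D_t / √n)` has expectation `1`, and
`exp (i θ ∑ D_t / √n)` divided by it tends to `exp (-θ² v / 2)` once the averages of `D_t²` tend to
`v`; the latter follows from the strong law. Lévy's continuity theorem concludes. The value of `v` is the sum
of the stationary autocovariances (`IsSummablyErgodic.variance_martingale_step`). The initial law
plays no role at any point.
-/

/-! ### A central limit theorem and a strong law for martingale-like sums -/

theorem norm_prod_sub_prod_le {ι R : Type*} [NormedCommRing R] [NormOneClass R] (s : Finset ι)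
    (a b : ι → R) (ha : ∀ i ∈ s, ‖a i‖ ≤ 1) (hb : ∀ i ∈ s, ‖b i‖ ≤ 1) :
    ‖∏ i ∈ s, a i - ∏ i ∈ s, b i‖ ≤ ∑ i ∈ s, ‖a i - b i‖ := by
  classical
  induction s using Finset.induction_on with
  | empty => simp
  | insert j s hj ih =>
    rw [Finset.prod_insert hj, Finset.prod_insert hj, Finset.sum_insert hj]
    have ih' := ih (fun i hi => ha i (Finset.mem_insert_of_mem hi))
      (fun i hi => hb i (Finset.mem_insert_of_mem hi))
    have hbs : ‖∏ i ∈ s, b i‖ ≤ 1 := (Finset.norm_prod_le s b).trans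
      (Finset.prod_le_one (fun _ _ => norm_nonneg _)
        fun i hi => hb i (Finset.mem_insert_of_mem hi))
    calc ‖a j * ∏ i ∈ s, a i - b j * ∏ i ∈ s, b i‖
        = ‖(a j - b j) * ∏ i ∈ s, b i + a j * (∏ i ∈ s, a i - ∏ i ∈ s, b i)‖ := by
          congr 1; ring
      _ ≤ ‖a j - b j‖ * ‖∏ i ∈ s, b i‖ + ‖a j‖ * ‖∏ i ∈ s, a i - ∏ i ∈ s, b i‖ :=
          (norm_add_le _ _).trans (add_le_add (norm_mul_le _ _) (norm_mul_le _ _))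
      _ ≤ ‖a j - b j‖ * 1 + 1 * ∑ i ∈ s, ‖a i - b i‖ := by
          gcongr
          exact ha j (Finset.mem_insert_self j s)
      _ = _ := by ring

/-- Second-order comparison of `exp (i x)` with `(1 + i x) exp (-x² / 2)`; the Taylor polynomials of
both sides agree up to order two. -/
theorem norm_exp_mul_I_sub_le {x : ℝ} (hx : |x| ≤ 1) :
    ‖Complex.exp (x * Complex.I) - (1 + x * Complex.I) * Real.exp (-(x ^ 2 / 2))‖ ≤
      2 * |x| ^ 3 := by
  have h1 := Complex.exp_bound (x := (x : ℂ) * Complex.I) (n := 3) (by simpa using hx)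
    (by norm_num)
  have hx2 : x ^ 2 ≤ 1 := (sq_le_one_iff_abs_le_one x).2 hx
  have h2 := Complex.exp_bound (x := ((-(x ^ 2 / 2) : ℝ) : ℂ)) (n := 2)
    (by rw [Complex.norm_real, Real.norm_eq_abs, abs_neg, abs_of_nonneg (by positivity)]; linarith)
    (by norm_num)
  rw [Complex.norm_real, Real.norm_eq_abs, abs_neg, abs_of_nonneg (by positivity)] at h2
  simp only [Finset.sum_range_succ, Finset.sum_range_zero, Complex.norm_mul, Complex.norm_I,
    Complex.norm_real, Real.norm_eq_abs, mul_one] at h1 h2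
  norm_num [Nat.factorial] at h1 h2
  set E1 : ℂ := Complex.exp (x * Complex.I) - (1 + x * Complex.I + (x * Complex.I) ^ 2 / 2) with hE1
  set E2 : ℂ := Complex.exp (-((x : ℂ) ^ 2 / 2)) - (1 + -((x : ℂ) ^ 2 / 2)) with hE2
  have h3 : ‖1 + (x : ℂ) * Complex.I‖ ≤ 2 := by
    refine (norm_add_le _ _).trans ?_
    simp only [norm_one, Complex.norm_mul, Complex.norm_I, Complex.norm_real, Real.norm_eq_abs,
      mul_one]
    linarith
  have key : Complex.exp (x * Complex.I) - (1 + x * Complex.I) * Real.exp (-(x ^ 2 / 2)) =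
      E1 + (x : ℂ) ^ 3 * Complex.I / 2 - (1 + x * Complex.I) * E2 := by
    rw [hE1, hE2]
    push_cast
    linear_combination ((x : ℂ) ^ 2 / 2) * Complex.I_sq
  have h4 : ‖E2‖ ≤ |x| ^ 3 * (3 / 16) := by
    refine h2.trans ?_
    have : x ^ 4 ≤ |x| ^ 3 := by
      calc x ^ 4 = |x| ^ 4 := by rw [← abs_pow, abs_of_nonneg (by positivity)]
        _ ≤ |x| ^ 3 := pow_le_pow_of_le_one (abs_nonneg x) hx (by norm_num)
    nlinarith
  have h5 : ‖(x : ℂ) ^ 3 * Complex.I / 2‖ = |x| ^ 3 / 2 := by simp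
  rw [key]
  calc _ ≤ ‖E1‖ + ‖(x : ℂ) ^ 3 * Complex.I / 2‖ + ‖1 + x * Complex.I‖ * ‖E2‖ :=
        (norm_sub_le _ _).trans (add_le_add (norm_add_le _ _) (norm_mul_le _ _))
    _ ≤ |x| ^ 3 * (2 / 9) + |x| ^ 3 / 2 + 2 * (|x| ^ 3 * (3 / 16)) := by
        rw [h5]; gcongr
    _ ≤ _ := by nlinarith [pow_nonneg (abs_nonneg x) 3]

theorem one_le_norm_one_add_mul_I (x : ℝ) : 1 ≤ ‖1 + (x : ℂ) * Complex.I‖ := by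
  have := Complex.abs_re_le_norm (1 + (x : ℂ) * Complex.I)
  simpa using this

theorem norm_one_add_mul_I_le (x : ℝ) : ‖1 + (x : ℂ) * Complex.I‖ ≤ Real.exp (x ^ 2 / 2) := by
  have h : ‖1 + (x : ℂ) * Complex.I‖ ^ 2 = 1 + x ^ 2 := by
    rw [Complex.sq_norm, Complex.normSq_apply]; simp; ring
  refine le_of_sq_le_sq ?_ (Real.exp_pos _).le
  rw [h, ← Real.exp_nat_mul]
  have := Real.add_one_le_exp (x ^ 2)
  push_cast
  rw [show (2 : ℝ) * (x ^ 2 / 2) = x ^ 2 by ring]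
  linarith

/-- The correction factor `∏ exp (i x_t) / (1 + i x_t)` with `x_t = θ d_t / √n` is asymptotically
`∏ exp (-x_t² / 2)`, so its limit depends on the averages of `d_t²` alone. No probability is
involved: the bound on `d` makes each factor differ by `O(n ^ (-3/2))`. -/
theorem tendsto_prod_exp_div {d : ℕ → ℝ} {B v : ℝ} (hB : ∀ t, |d t| ≤ B)
    (hv : Tendsto (fun n : ℕ => (∑ t ∈ Finset.range n, d t ^ 2) / (n : ℝ)) atTop (𝓝 v)) (θ : ℝ) :
    Tendsto (fun n : ℕ => ∏ t ∈ Finset.range n,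
      Complex.exp ((θ / √n * d t : ℝ) * Complex.I) / (1 + (θ / √n * d t : ℝ) * Complex.I))
      atTop (𝓝 (Real.exp (-(θ ^ 2 * v / 2)) : ℂ)) := by
  have hmain : Tendsto (fun n : ℕ => ((∏ t ∈ Finset.range n,
      Real.exp (-((θ / √n * d t) ^ 2 / 2)) : ℝ) : ℂ)) atTop
      (𝓝 (Real.exp (-(θ ^ 2 * v / 2)) : ℂ)) := by
    refine (Complex.continuous_ofReal.tendsto _).comp ?_
    simp_rw [← Real.exp_sum]
    refine (Real.continuous_exp.tendsto _).comp ?_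
    have h := (hv.const_mul (-(θ ^ 2 / 2)))
    rw [show -(θ ^ 2 / 2) * v = -(θ ^ 2 * v / 2) by ring] at h
    refine h.congr fun n => ?_
    rw [Finset.sum_div, Finset.mul_sum]
    refine Finset.sum_congr rfl fun t _ => ?_
    rw [mul_pow, div_pow, Real.sq_sqrt (Nat.cast_nonneg n)]
    ring
  have hsm : Tendsto (fun n : ℕ => |θ| * B / √n) atTop (𝓝 0) :=
    tendsto_const_nhds.div_atTop (Real.tendsto_sqrt_atTop.comp tendsto_natCast_atTop_atTop)
  have hB0 : 0 ≤ B := (abs_nonneg _).trans (hB 0)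
  have hdiff : Tendsto (fun n : ℕ => (∏ t ∈ Finset.range n,
      Complex.exp ((θ / √n * d t : ℝ) * Complex.I) / (1 + (θ / √n * d t : ℝ) * Complex.I)) -
      ((∏ t ∈ Finset.range n, Real.exp (-((θ / √n * d t) ^ 2 / 2)) : ℝ) : ℂ)) atTop (𝓝 0) := by
    have hlim := hsm.const_mul (2 * (|θ| * B) ^ 2)
    rw [mul_zero] at hlim
    refine squeeze_zero_norm' ?_ hlim
    filter_upwards [hsm.eventually_le_const one_pos, eventually_gt_atTop 0] with n hn hn0
    have hsq : √(n : ℝ) ^ 2 = n := Real.sq_sqrt (Nat.cast_nonneg n)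
    have hspos : 0 < √(n : ℝ) := Real.sqrt_pos.2 (by exact_mod_cast hn0)
    have hx : ∀ t, |θ / √n * d t| ≤ |θ| * B / √n := fun t => by
      rw [abs_mul, abs_div, abs_of_pos hspos, div_mul_eq_mul_div]
      gcongr
      exact hB t
    -- All factors have norm at most `1`, so the error is at most `n * 2 * (|θ| B / √n) ^ 3`.
    rw [Complex.ofReal_prod]
    refine (norm_prod_sub_prod_le _ _ _ (fun t _ => ?_) (fun t _ => ?_)).trans ?_
    · rw [norm_div, Complex.norm_exp_ofReal_mul_I]
      exact div_le_one_of_le₀ (one_le_norm_one_add_mul_I _) (norm_nonneg _)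
    · rw [Complex.norm_real, Real.norm_eq_abs, Real.abs_exp, Real.exp_le_one_iff]
      have := sq_nonneg (θ / √n * d t)
      linarith
    · have hterm : ∀ t ∈ Finset.range n, ‖Complex.exp ((θ / √n * d t : ℝ) * Complex.I) /
          (1 + (θ / √n * d t : ℝ) * Complex.I) - (Real.exp (-((θ / √n * d t) ^ 2 / 2)) : ℂ)‖ ≤
          2 * (|θ| * B / √n) ^ 3 := fun t _ => by
        have h1 := one_le_norm_one_add_mul_I (θ / √n * d t)
        have hne : 1 + ((θ / √n * d t : ℝ) : ℂ) * Complex.I ≠ 0 :=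
          norm_pos_iff.1 (one_pos.trans_le h1)
        have h2 := norm_exp_mul_I_sub_le ((hx t).trans hn)
        rw [div_sub' hne, norm_div]
        refine (div_le_self (norm_nonneg _) h1).trans (h2.trans ?_)
        gcongr
        exact hx t
      refine (Finset.sum_le_sum hterm).trans_eq ?_
      rw [Finset.sum_const, Finset.card_range, nsmul_eq_mul]
      have hs := hspos.ne'
      generalize √(n : ℝ) = r at hs hsq ⊢
      rw [← hsq]
      field_simp
  have := hdiff.add hmain
  simpa using this

/-- McLeish's central limit theorem for bounded increments. The hypothesis `hprod` is the only trace
of the martingale property. With `T = ∏ (1 + i θ D_t / √n)` one has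
`exp (i θ ∑ D_t / √n) = T * U`, where `E T = 1`, `T` is bounded uniformly in `n`, and `U` tends
boundedly to the constant `exp (-θ² v / 2)`. -/
theorem tendstoInDistribution_gaussian_of_integral_prod_eq_one {Ω : Type*} [MeasurableSpace Ω]
    {μ : Measure Ω} [IsProbabilityMeasure μ] {D : ℕ → Ω → ℝ} {B : ℝ} {v : ℝ≥0}
    (hD : ∀ t, Measurable (D t)) (hB : ∀ t ω, |D t ω| ≤ B)
    (hprod : ∀ (n : ℕ) (θ : ℝ),
      ∫ ω, ∏ t ∈ Finset.range n, (1 + (θ * D t ω : ℝ) * Complex.I) ∂μ = 1)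
    (hsq : ∀ᵐ ω ∂μ, Tendsto (fun n : ℕ => (∑ t ∈ Finset.range n, D t ω ^ 2) / (n : ℝ)) atTop
      (𝓝 (v : ℝ))) :
    TendstoInDistribution (fun (n : ℕ) ω => (∑ t ∈ Finset.range n, D t ω) / √n) atTop
      (id : ℝ → ℝ) (fun _ => μ) (gaussianReal 0 v) := by
  have hmeas : ∀ n : ℕ, Measurable fun ω => (∑ t ∈ Finset.range n, D t ω) / √(n : ℝ) :=
    fun n => (Finset.measurable_fun_sum _ fun t _ => hD t).div_const _
  refine ⟨fun n => (hmeas n).aemeasurable, aemeasurable_id, ?_⟩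
  refine ProbabilityMeasure.tendsto_iff_tendsto_charFun.2 fun θ => ?_
  simp only [ProbabilityMeasure.coe_mk, Measure.map_id, charFun_gaussianReal]
  set c : ℂ := (Real.exp (-(θ ^ 2 * v / 2)) : ℂ) with hc
  have hcc : Complex.exp (θ * (0 : ℝ) * Complex.I - v * θ ^ 2 / 2) = c := by
    rw [hc]; push_cast; congr 1; ring
  rw [hcc]
  set T : ℕ → Ω → ℂ := fun n ω =>
    ∏ t ∈ Finset.range n, (1 + (θ / √n * D t ω : ℝ) * Complex.I) with hT
  set U : ℕ → Ω → ℂ := fun n ω => ∏ t ∈ Finset.range n,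
    Complex.exp ((θ / √n * D t ω : ℝ) * Complex.I) / (1 + (θ / √n * D t ω : ℝ) * Complex.I) with hU
  have hTm : ∀ n, Measurable (T n) := fun n => by
    refine Finset.measurable_fun_prod _ fun t _ => ?_
    have := hD t
    fun_prop
  have hUm : ∀ n, Measurable (U n) := fun n => by
    refine Finset.measurable_fun_prod _ fun t _ => ?_
    have := hD t
    fun_prop
  have hTb : ∀ n ω, ‖T n ω‖ ≤ Real.exp (θ ^ 2 * B ^ 2 / 2) := fun n ω => by
    rw [hT]
    simp only [norm_prod]
    calc _ ≤ ∏ t ∈ Finset.range n, Real.exp ((θ / √n * D t ω) ^ 2 / 2) :=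
          Finset.prod_le_prod (fun _ _ => norm_nonneg _) fun t _ => norm_one_add_mul_I_le _
      _ = Real.exp (∑ t ∈ Finset.range n, (θ / √n * D t ω) ^ 2 / 2) := (Real.exp_sum _ _).symm
      _ ≤ _ := by
        refine Real.exp_le_exp.2 ?_
        have h1 : ∀ t ∈ Finset.range n, (θ / √n * D t ω) ^ 2 / 2 ≤ θ ^ 2 / n * B ^ 2 / 2 :=
          fun t _ => by
            rw [mul_pow, div_pow, Real.sq_sqrt (Nat.cast_nonneg n)]
            have h2 : D t ω ^ 2 ≤ B ^ 2 := sq_le_sq.2 ((hB t ω).trans (le_abs_self B))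
            gcongr
        refine (Finset.sum_le_sum h1).trans ?_
        rw [Finset.sum_const, Finset.card_range, nsmul_eq_mul]
        rcases Nat.eq_zero_or_pos n with rfl | hn
        · simp; positivity
        · apply le_of_eq; field_simp
  have hUb : ∀ n ω, ‖U n ω‖ ≤ 1 := fun n ω => by
    rw [hU]
    simp only [norm_prod]
    refine Finset.prod_le_one (fun _ _ => norm_nonneg _) fun t _ => ?_
    rw [norm_div, Complex.norm_exp_ofReal_mul_I]
    exact div_le_one_of_le₀ (one_le_norm_one_add_mul_I _) (norm_nonneg _)
  have hcb : ‖c‖ ≤ 1 := by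
    rw [hc, Complex.norm_real, Real.norm_eq_abs, Real.abs_exp, Real.exp_le_one_iff]
    have : 0 ≤ θ ^ 2 * (v : ℝ) := by positivity
    linarith
  have hTU : ∀ n ω, Complex.exp (θ * ((∑ t ∈ Finset.range n, D t ω) / √(n : ℝ) : ℝ) * Complex.I) =
      T n ω * U n ω := fun n ω => by
    rw [hT, hU]
    simp only
    rw [← Finset.prod_mul_distrib]
    have : ∀ t ∈ Finset.range n, (1 + (θ / √n * D t ω : ℝ) * Complex.I) *
        (Complex.exp ((θ / √n * D t ω : ℝ) * Complex.I) / (1 + (θ / √n * D t ω : ℝ) * Complex.I)) =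
        Complex.exp ((θ / √n * D t ω : ℝ) * Complex.I) := fun t _ => by
      have h1 := one_le_norm_one_add_mul_I (θ / √n * D t ω)
      exact mul_div_cancel₀ _ (norm_pos_iff.1 (one_pos.trans_le h1))
    rw [Finset.prod_congr rfl this, ← Complex.exp_sum]
    congr 1
    rw [← Finset.sum_mul]
    congr 1
    push_cast
    rw [Finset.sum_div, Finset.mul_sum]
    exact Finset.sum_congr rfl fun t _ => by ring
  have hTint : ∀ n, Integrable (T n) μ := fun n =>
    Integrable.of_bound (hTm n).aestronglyMeasurable _ (ae_of_all _ (hTb n))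
  have hlim : Tendsto (fun n => ∫ ω, T n ω * (U n ω - c) ∂μ) atTop (𝓝 (∫ _, (0 : ℂ) ∂μ)) := by
    refine tendsto_integral_of_dominated_convergence
      (fun _ => Real.exp (θ ^ 2 * B ^ 2 / 2) * 2)
      (fun n => ((hTm n).mul ((hUm n).sub_const c)).aestronglyMeasurable)
      (integrable_const _) (fun n => ae_of_all _ fun ω => ?_) ?_
    · rw [norm_mul]
      gcongr
      · exact hTb n ω
      · exact (norm_sub_le _ _).trans (by linarith [hUb n ω])
    · filter_upwards [hsq] with ω hω
      have h1 := tendsto_prod_exp_div (fun t => hB t ω) hω θ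
      have h2 : Tendsto (fun n => U n ω - c) atTop (𝓝 0) := by
        simpa [hU, hc] using h1.sub_const c
      refine squeeze_zero_norm (fun n => ?_)
        (by simpa using h2.norm.const_mul (Real.exp (θ ^ 2 * B ^ 2 / 2)))
      rw [norm_mul]
      gcongr
      exact hTb n ω
  have hfin := hlim.add_const c
  simp only [integral_zero, zero_add] at hfin
  refine hfin.congr fun n => ?_
  rw [charFun_apply_real, integral_map (hmeas n).aemeasurable (by fun_prop)]
  simp_rw [hTU]
  have hT1 : ∫ ω, T n ω ∂μ = 1 := hprod n (θ / √n)
  have hTUint : Integrable (fun ω => T n ω * (U n ω - c)) μ :=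
    (hTint n).mul_bdd (c := 2) ((hUm n).sub_const c).aestronglyMeasurable
      (ae_of_all _ fun ω => (norm_sub_le _ _).trans (by linarith [hUb n ω]))
  calc ∫ ω, T n ω * (U n ω - c) ∂μ + c
      = ∫ ω, T n ω * (U n ω - c) ∂μ + ∫ ω, T n ω * c ∂μ := by
        rw [integral_mul_const, hT1, one_mul]
    _ = ∫ ω, T n ω * U n ω ∂μ := by
        rw [← integral_add hTUint ((hTint n).mul_const c)]
        exact integral_congr_ae (ae_of_all _ fun ω => by simp only; ring)

/-- If `E[M_n ^ 4] = O(n²)` then `∑ (M_n / n) ^ 4` has finite expectation, so `M_n / n → 0` almost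
surely. -/
theorem ae_tendsto_div_zero_of_integral_pow_four_le {Ω : Type*} [MeasurableSpace Ω]
    {μ : Measure Ω} {M : ℕ → Ω → ℝ} {K : ℝ} (hint : ∀ n, Integrable (fun ω => M n ω ^ 4) μ)
    (hM : ∀ n : ℕ, ∫ ω, M n ω ^ 4 ∂μ ≤ K * (n : ℝ) ^ 2) :
    ∀ᵐ ω ∂μ, Tendsto (fun n : ℕ => M n ω / (n : ℝ)) atTop (𝓝 0) := by
  have hi : ∀ n : ℕ, Integrable (fun ω => (M n ω / (n : ℝ)) ^ 4) μ := fun n => by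
    simp_rw [div_pow]
    exact (hint n).div_const _
  have hpos : ∀ n : ℕ, ∀ ω, 0 ≤ (M n ω / (n : ℝ)) ^ 4 := fun n ω => by positivity
  have hle : ∀ n : ℕ, ∫ ω, (M n ω / (n : ℝ)) ^ 4 ∂μ ≤ K * (1 / (n : ℝ) ^ 2) := fun n => by
    simp_rw [div_pow]
    rw [integral_div]
    rcases Nat.eq_zero_or_pos n with rfl | hn
    · simp
    · rw [div_le_iff₀ (by positivity)]
      refine (hM n).trans_eq ?_
      field_simp
  have hsum : Summable fun n : ℕ => ∫ ω, (M n ω / (n : ℝ)) ^ 4 ∂μ :=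
    Summable.of_nonneg_of_le (fun n => integral_nonneg (hpos n)) hle
      ((Real.summable_one_div_nat_pow.2 (by norm_num)).mul_left K)
  have hfin : ∫⁻ ω, ∑' n : ℕ, ENNReal.ofReal ((M n ω / (n : ℝ)) ^ 4) ∂μ ≠ ⊤ := by
    rw [lintegral_tsum fun n => (hi n).aemeasurable.ennreal_ofReal]
    simp_rw [← ofReal_integral_eq_lintegral_ofReal (hi _) (ae_of_all _ (hpos _))]
    rw [← ENNReal.ofReal_tsum_of_nonneg (fun n => integral_nonneg (hpos n)) hsum]
    exact ENNReal.ofReal_ne_top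
  filter_upwards [ae_lt_top' (AEMeasurable.tsum fun n =>
    (hi n).aemeasurable.ennreal_ofReal) hfin] with ω hω
  have h1 := ENNReal.tendsto_atTop_zero_of_tsum_ne_top hω.ne
  have h2 : Tendsto (fun n : ℕ => (M n ω / (n : ℝ)) ^ 4) atTop (𝓝 0) := by
    have := (ENNReal.tendsto_toReal ENNReal.zero_ne_top).comp h1
    refine this.congr fun n => ?_
    simp [ENNReal.toReal_ofReal (hpos n ω)]
  rw [tendsto_zero_iff_abs_tendsto_zero]
  have h3 := ((Real.continuous_sqrt.comp Real.continuous_sqrt).tendsto 0).comp h2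
  simp only [Function.comp_def, Real.sqrt_zero] at h3
  refine h3.congr fun n => ?_
  rw [show (M n ω / (n : ℝ)) ^ 4 = ((M n ω / (n : ℝ)) ^ 2) ^ 2 by ring,
    Real.sqrt_sq (by positivity), Real.sqrt_sq_eq_abs]
  rfl

/-! ### Martingale increments along a finite Markov chain -/

theorem dependsOn_sum_steps {α : Type*} (ψ : α → α → ℝ) (n : ℕ) :
    DependsOn (fun z : ℕ → α => ∑ t ∈ Finset.range n, ψ (z t) (z (t + 1))) (Set.Iic n) := by
  intro x y h
  refine Finset.sum_congr rfl fun t ht => ?_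
  have ht := Finset.mem_range.1 ht
  rw [h t (Set.mem_Iic.2 ht.le), h (t + 1) (Set.mem_Iic.2 ht)]

namespace IsMarkovChain

variable {Ω α : Type*} [MeasurableSpace Ω] {μ : Measure Ω}
  [Fintype α] [MeasurableSpace α] [MeasurableSingletonClass α]
  {P : α → α → ℝ} {Z : ℕ → Ω → α}

theorem measurable_step (hZ : IsMarkovChain μ P Z) (ψ : α → α → ℝ) (t : ℕ) :
    Measurable fun ω => ψ (Z t ω) (Z (t + 1) ω) :=
  (measurable_of_finite fun x : α × α => ψ x.1 x.2).comp
    ((hZ.measurable t).prodMk (hZ.measurable (t + 1)))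

variable [IsProbabilityMeasure μ]

theorem integrable_of_dependsOn {E : Type*} [NormedAddCommGroup E]
    (hZ : IsMarkovChain μ P Z) {t : ℕ} {Φ : (ℕ → α) → E} (hΦ : DependsOn Φ (Set.Iic t)) :
    Integrable (fun ω => Φ fun s => Z s ω) μ := by
  classical
  obtain ⟨φ, rfl⟩ := dependsOn_iff_exists_comp.1 hΦ
  have hH : Measurable fun ω => (fun s : Set.Iic t => Z s ω) :=
    measurable_pi_lambda _ fun s => hZ.measurable s
  have : Integrable φ (μ.map fun ω => (fun s : Set.Iic t => Z s ω)) := Integrable.of_finite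
  exact this.comp_measurable hH

/-- The martingale property of `ψ (Z_t, Z_{t+1})` for a kernel `ψ` that is centred under every row
of `P`: it is orthogonal to every functional `Φ` of the path up to time `t`. Since the state
space is finite, this is a finite sum over the paths of length `t + 2`. -/
theorem integral_smul_eq_zero {E : Type*} [NormedAddCommGroup E] [NormedSpace ℝ E] [CompleteSpace E]
    (hZ : IsMarkovChain μ P Z) {ψ : α → α → ℝ} (hψ : ∀ a, ∑ b, P a b * ψ a b = 0) {t : ℕ}
    {Φ : (ℕ → α) → E} (hΦ : DependsOn Φ (Set.Iic t)) :
    ∫ ω, ψ (Z t ω) (Z (t + 1) ω) • Φ (fun s => Z s ω) ∂μ = 0 := by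
  classical
  obtain ⟨φ, rfl⟩ := dependsOn_iff_exists_comp.1 hΦ
  have hH : Measurable fun ω => ((fun s : Set.Iic t => Z s ω), Z (t + 1) ω) :=
    (measurable_pi_lambda _ fun s : Set.Iic t => hZ.measurable s).prodMk (hZ.measurable _)
  let F : (Set.Iic t → α) × α → E := fun x => ψ (x.1 ⟨t, le_refl t⟩) x.2 • φ x.1
  have hFs : AEStronglyMeasurable F (μ.map fun ω => ((fun s : Set.Iic t => Z s ω), Z (t + 1) ω)) :=
    (Integrable.of_finite (f := F)).aestronglyMeasurable
  have h1 : ∫ ω, ψ (Z t ω) (Z (t + 1) ω) • (φ ∘ (Set.Iic t).domRestrict) (fun s => Z s ω) ∂μ =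
      ∫ x, F x ∂(μ.map fun ω => ((fun s : Set.Iic t => Z s ω), Z (t + 1) ω)) :=
    (integral_map hH.aemeasurable hFs).symm
  rw [h1, integral_fintype .of_finite, Fintype.sum_prod_type]
  refine Finset.sum_eq_zero fun x _ => ?_
  have h2 : ∀ b, (μ.map fun ω => ((fun s : Set.Iic t => Z s ω), Z (t + 1) ω)).real {(x, b)} =
      μ.real {ω | ∀ s : Set.Iic t, Z s ω = x s} * P (x ⟨t, le_refl t⟩) b := fun b => by
    -- The Markov property is stated for infinite sequences; beyond `t` the entries of `a` are `b`.
    let a : ℕ → α := fun s => if hs : s ≤ t then x ⟨s, hs⟩ else b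
    have ha : ∀ s, ∀ hs : s ≤ t, a s = x ⟨s, hs⟩ := fun s hs => dif_pos hs
    have hb : a (t + 1) = b := dif_neg (by omega)
    rw [map_measureReal_apply hH (measurableSet_singleton _)]
    have h3 := hZ.step t a
    rw [ha t le_rfl, hb] at h3
    convert h3 using 3
    · ext ω
      simp only [Set.mem_preimage, Set.mem_singleton_iff, Prod.mk.injEq, funext_iff,
        Set.mem_ofPred_eq, Subtype.forall, Set.mem_Iic]
      constructor
      · rintro ⟨h, h'⟩ s hs
        rcases Nat.le_succ_iff.1 hs with hs | rfl
        · rw [ha s hs]; exact h s hs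
        · rw [h', ← hb]
      · intro h
        exact ⟨fun s hs => by rw [h s (by omega), ha s hs], by rw [h _ le_rfl, hb]⟩
    · ext ω
      simp only [Set.mem_ofPred_eq, Subtype.forall, Set.mem_Iic]
      exact forall₂_congr fun s hs => by rw [ha s hs]
  simp_rw [h2, F, smul_smul, ← Finset.sum_smul]
  have h4 : ∑ b, μ.real {ω | ∀ s : Set.Iic t, Z s ω = x s} * P (x ⟨t, le_refl t⟩) b *
      ψ (x ⟨t, le_refl t⟩) b = 0 := by
    simp_rw [mul_assoc]
    rw [← Finset.mul_sum, hψ, mul_zero]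
  rw [h4, zero_smul]

theorem integral_mul_eq_zero (hZ : IsMarkovChain μ P Z) {ψ : α → α → ℝ}
    (hψ : ∀ a, ∑ b, P a b * ψ a b = 0) {t : ℕ} {Φ : (ℕ → α) → ℝ}
    (hΦ : DependsOn Φ (Set.Iic t)) :
    ∫ ω, Φ (fun s => Z s ω) * ψ (Z t ω) (Z (t + 1) ω) ∂μ = 0 := by
  simpa [mul_comm] using hZ.integral_smul_eq_zero hψ hΦ

/-- Moment bounds for a martingale with increments bounded by `B`. The fourth moment needs the second
one, so the two are proved in one induction. -/
theorem integral_sum_steps_pow_le (hZ : IsMarkovChain μ P Z) {ψ : α → α → ℝ} {B : ℝ}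
    (hψ : ∀ a, ∑ b, P a b * ψ a b = 0) (hB : ∀ a b, |ψ a b| ≤ B) (n : ℕ) :
    ∫ ω, (∑ t ∈ Finset.range n, ψ (Z t ω) (Z (t + 1) ω)) ^ 2 ∂μ ≤ B ^ 2 * n ∧
    ∫ ω, (∑ t ∈ Finset.range n, ψ (Z t ω) (Z (t + 1) ω)) ^ 4 ∂μ ≤ 4 * B ^ 4 * (n : ℝ) ^ 2 := by
  induction n with
  | zero => simp
  | succ n ih =>
    obtain ⟨ih2, ih4⟩ := ih
    set M : (ℕ → α) → ℝ := fun z => ∑ t ∈ Finset.range n, ψ (z t) (z (t + 1)) with hM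
    have hMd : DependsOn M (Set.Iic n) := dependsOn_sum_steps ψ n
    have hpow : ∀ k, DependsOn (fun z => M z ^ k) (Set.Iic n) := fun k x y h => by
      simp only [hMd h]
    have hpow' : ∀ k, DependsOn (fun z : ℕ → α =>
        (∑ t ∈ Finset.range (n + 1), ψ (z t) (z (t + 1))) ^ k) (Set.Iic (n + 1)) :=
      fun k x y h => by
        have := dependsOn_sum_steps ψ (n + 1) h
        simp only at this ⊢
        rw [this]
    have hcross : ∀ k, DependsOn (fun z : ℕ → α => M z ^ k * ψ (z n) (z (n + 1)))
        (Set.Iic (n + 1)) := fun k x y h => by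
      have h' : M x = M y := hMd fun i hi => h i (Set.mem_Iic.2 ((Set.mem_Iic.1 hi).trans (by omega)))
      simp only
      rw [h', h n (Set.mem_Iic.2 (by omega)), h (n + 1) (Set.mem_Iic.2 le_rfl)]
    have hi := fun k => hZ.integrable_of_dependsOn (hpow k)
    have hi' := fun k => hZ.integrable_of_dependsOn (hpow' k)
    have hic := fun k => hZ.integrable_of_dependsOn (hcross k)
    have hsq : ∀ ω, ψ (Z n ω) (Z (n + 1) ω) ^ 2 ≤ B ^ 2 := fun ω =>
      sq_le_sq.2 ((hB _ _).trans (le_abs_self B))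
    have hz := fun k => hZ.integral_mul_eq_zero hψ (hpow k)
    have hz1 := hz 1
    have hz3 := hz 3
    have i2 : Integrable (fun ω => M (fun s => Z s ω) ^ 2 +
        2 * (M (fun s => Z s ω) ^ 1 * ψ (Z n ω) (Z (n + 1) ω))) μ :=
      (hi 2).add ((hic 1).const_mul 2)
    have i3 : Integrable (fun ω => M (fun s => Z s ω) ^ 4 +
        4 * (M (fun s => Z s ω) ^ 3 * ψ (Z n ω) (Z (n + 1) ω))) μ :=
      (hi 4).add ((hic 3).const_mul 4)
    have i4 : Integrable (fun ω => M (fun s => Z s ω) ^ 4 +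
        4 * (M (fun s => Z s ω) ^ 3 * ψ (Z n ω) (Z (n + 1) ω)) +
        8 * B ^ 2 * M (fun s => Z s ω) ^ 2) μ := i3.add ((hi 2).const_mul (8 * B ^ 2))
    simp only [Finset.sum_range_succ] at hi' ⊢
    constructor
    · calc _ ≤ ∫ ω, (M (fun s => Z s ω) ^ 2 +
            2 * (M (fun s => Z s ω) ^ 1 * ψ (Z n ω) (Z (n + 1) ω)) + B ^ 2) ∂μ := by
            refine integral_mono (hi' 2)
              (i2.add (integrable_const _)) fun ω => ?_
            simp only [hM]
            linarith [hsq ω]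
        _ = ∫ ω, M (fun s => Z s ω) ^ 2 ∂μ + B ^ 2 := by
            rw [integral_add i2 (integrable_const _),
              integral_add (hi 2) ((hic 1).const_mul 2), integral_const_mul, hz1]
            simp
        _ ≤ _ := by push_cast; linarith
    · calc _ ≤ ∫ ω, (M (fun s => Z s ω) ^ 4 +
            4 * (M (fun s => Z s ω) ^ 3 * ψ (Z n ω) (Z (n + 1) ω)) +
            8 * B ^ 2 * M (fun s => Z s ω) ^ 2 + 3 * B ^ 4) ∂μ := by
            refine integral_mono (hi' 4)
              (i4.add (integrable_const _)) fun ω => ?_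
            simp only
            change (M (fun s => Z s ω) + ψ (Z n ω) (Z (n + 1) ω)) ^ 4 ≤ _
            generalize M (fun s => Z s ω) = m
            have h2 := hsq ω
            generalize ψ (Z n ω) (Z (n + 1) ω) = d at h2
            -- `4 m d³ ≤ 2 m² d² + 2 d⁴` removes the odd term of the binomial expansion.
            have h4 : (d ^ 2) ^ 2 ≤ (B ^ 2) ^ 2 := pow_le_pow_left₀ (sq_nonneg d) h2 2
            have h5 : m ^ 2 * d ^ 2 ≤ m ^ 2 * B ^ 2 := mul_le_mul_of_nonneg_left h2 (sq_nonneg m)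
            have h6 : 0 ≤ 2 * (d ^ 2 * (m - d) ^ 2) := by positivity
            linarith
        _ = ∫ ω, M (fun s => Z s ω) ^ 4 ∂μ + 8 * B ^ 2 * ∫ ω, M (fun s => Z s ω) ^ 2 ∂μ +
              3 * B ^ 4 := by
            rw [integral_add i4 (integrable_const _),
              integral_add i3 ((hi 2).const_mul (8 * B ^ 2)),
              integral_add (hi 4) ((hic 3).const_mul 4), integral_const_mul, integral_const_mul,
              hz3]
            simp
        _ ≤ _ := by
            have h7 := mul_le_mul_of_nonneg_left ih2 (by positivity : 0 ≤ 8 * B ^ 2)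
            have h8 : 0 ≤ B ^ 4 := by positivity
            push_cast
            linarith

theorem ae_tendsto_sum_steps_div (hZ : IsMarkovChain μ P Z) {ψ : α → α → ℝ}
    (hψ : ∀ a, ∑ b, P a b * ψ a b = 0) :
    ∀ᵐ ω ∂μ, Tendsto (fun n : ℕ => (∑ t ∈ Finset.range n, ψ (Z t ω) (Z (t + 1) ω)) / (n : ℝ))
      atTop (𝓝 0) := by
  obtain ⟨B, hB⟩ := Finite.bddAbove_range fun x : α × α => |ψ x.1 x.2|
  refine ae_tendsto_div_zero_of_integral_pow_four_le (K := 4 * B ^ 4) (fun n => ?_) fun n =>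
    (hZ.integral_sum_steps_pow_le hψ (fun a b => hB ⟨(a, b), rfl⟩) n).2
  exact hZ.integrable_of_dependsOn
    (Φ := fun z => (∑ t ∈ Finset.range n, ψ (z t) (z (t + 1))) ^ 4) (t := n)
    fun x y h => by
      have := dependsOn_sum_steps ψ n h
      simp only at this ⊢
      rw [this]

/-- The product `∏ (1 + i θ ψ (Z_t, Z_{t+1}))` is a complex martingale started at `1`. -/
theorem integral_prod_steps (hZ : IsMarkovChain μ P Z) {ψ : α → α → ℝ}
    (hψ : ∀ a, ∑ b, P a b * ψ a b = 0) (n : ℕ) (θ : ℝ) :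
    ∫ ω, ∏ t ∈ Finset.range n, (1 + (θ * ψ (Z t ω) (Z (t + 1) ω) : ℝ) * Complex.I) ∂μ = 1 := by
  induction n with
  | zero => simp
  | succ n ih =>
    set T : (ℕ → α) → ℂ := fun z =>
      ∏ t ∈ Finset.range n, (1 + (θ * ψ (z t) (z (t + 1)) : ℝ) * Complex.I) with hT
    have hTd : DependsOn T (Set.Iic n) := fun x y h => by
      refine Finset.prod_congr rfl fun t ht => ?_
      have ht := Finset.mem_range.1 ht
      rw [h t (Set.mem_Iic.2 ht.le), h (t + 1) (Set.mem_Iic.2 ht)]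
    have hTd' : DependsOn (fun z => (θ * Complex.I) * T z) (Set.Iic n) := fun x y h => by
      simp only [hTd h]
    have hd : DependsOn (fun z : ℕ → α => ψ (z n) (z (n + 1)) • ((θ * Complex.I) * T z))
        (Set.Iic (n + 1)) := fun x y h => by
      have h' : T x = T y := hTd fun i hi => h i (Set.mem_Iic.2 ((Set.mem_Iic.1 hi).trans (by omega)))
      simp only
      rw [h', h n (Set.mem_Iic.2 (by omega)), h (n + 1) (Set.mem_Iic.2 le_rfl)]
    have key : ∀ ω, ∏ t ∈ Finset.range (n + 1),
        (1 + (θ * ψ (Z t ω) (Z (t + 1) ω) : ℝ) * Complex.I) = T (fun s => Z s ω) +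
          ψ (Z n ω) (Z (n + 1) ω) • ((θ * Complex.I) * T fun s => Z s ω) := fun ω => by
      rw [Finset.prod_range_succ, Complex.real_smul]
      simp only [hT]
      push_cast
      ring
    simp_rw [key]
    rw [integral_add (hZ.integrable_of_dependsOn hTd) (hZ.integrable_of_dependsOn hd),
      hZ.integral_smul_eq_zero hψ hTd', add_zero]
    exact ih

end IsMarkovChain

/-! ### Summably ergodic matrices and the Poisson equation -/

/-- The rows of `P` sum to one and the entries of `P ^ k` converge, summably in `k`, to `π` in every
row. No sign condition is needed; `π` is then invariant under `P` (`sum_mul_eq`) and sums to one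
(`sum_eq_one`). -/
structure IsSummablyErgodic {α : Type*} [Fintype α] [DecidableEq α] (P : Matrix α α ℝ)
    (π : α → ℝ) : Prop where
  row_sum : ∀ a, ∑ b, P a b = 1
  summable : ∀ a b, Summable fun k : ℕ => (P ^ k) a b - π b

/-- The potential `∑ₖ Pᵏ g`, the solution of the Poisson equation `u = g + P u` when `g` has mean
zero under the stationary law. It is a junk value wherever the series diverges. -/
noncomputable def potential {α : Type*} [Fintype α] [DecidableEq α] (P : Matrix α α ℝ)
    (g : α → ℝ) (a : α) : ℝ :=
  ∑' k : ℕ, ∑ b, (P ^ k) a b * g b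

namespace IsSummablyErgodic

variable {α : Type*} [Fintype α] [DecidableEq α] {P : Matrix α α ℝ} {π : α → ℝ}

theorem tendsto_pow (h : IsSummablyErgodic P π) (a b : α) :
    Tendsto (fun k : ℕ => (P ^ k) a b) atTop (𝓝 (π b)) := by
  simpa using (h.summable a b).tendsto_atTop_zero.add_const (π b)

theorem row_sum_pow (h : IsSummablyErgodic P π) (k : ℕ) (a : α) : ∑ b, (P ^ k) a b = 1 := by
  induction k generalizing a with
  | zero => simp [Matrix.one_apply]
  | succ k ih =>
    simp_rw [pow_succ, Matrix.mul_apply]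
    rw [Finset.sum_comm]
    simp_rw [← Finset.mul_sum, h.row_sum, mul_one, ih]

theorem sum_eq_one [Nonempty α] (h : IsSummablyErgodic P π) : ∑ b, π b = 1 := by
  obtain ⟨a⟩ := ‹Nonempty α›
  have h1 := tendsto_finsetSum Finset.univ fun b _ => h.tendsto_pow a b
  simp_rw [h.row_sum_pow] at h1
  exact tendsto_nhds_unique h1 tendsto_const_nhds

theorem sum_mul_eq [Nonempty α] (h : IsSummablyErgodic P π) (b : α) :
    ∑ a, π a * P a b = π b := by
  obtain ⟨c⟩ := ‹Nonempty α›
  have h1 : Tendsto (fun k : ℕ => ∑ a, (P ^ k) c a * P a b) atTop (𝓝 (∑ a, π a * P a b)) :=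
    tendsto_finsetSum Finset.univ fun a _ => (h.tendsto_pow c a).mul_const _
  refine tendsto_nhds_unique h1 (((h.tendsto_pow c b).comp (tendsto_add_atTop_nat 1)).congr ?_)
  intro k
  simp only [Function.comp_apply, pow_succ, Matrix.mul_apply]

theorem summable_pow_mul (h : IsSummablyErgodic P π) {g : α → ℝ} (hg : ∑ b, π b * g b = 0)
    (a : α) : Summable fun k : ℕ => ∑ b, (P ^ k) a b * g b := by
  have h1 : Summable fun k : ℕ => ∑ b, ((P ^ k) a b - π b) * g b :=
    summable_sum fun b _ => (h.summable a b).mul_right (g b)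
  refine h1.congr fun k => ?_
  simp_rw [sub_mul]
  rw [Finset.sum_sub_distrib, hg, sub_zero]

/-- `P (Pᵏ g) = Pᵏ⁺¹ g`, written out in coordinates. -/
theorem sum_mul_sum_pow_succ (P : Matrix α α ℝ) (g : α → ℝ) (k : ℕ) (a : α) :
    ∑ b, P a b * ∑ c, (P ^ k) b c * g c = ∑ c, (P ^ (k + 1)) a c * g c := by
  simp_rw [pow_succ', Matrix.mul_apply, Finset.mul_sum, Finset.sum_mul]
  rw [Finset.sum_comm]
  simp_rw [mul_assoc]

theorem potential_eq (h : IsSummablyErgodic P π) {g : α → ℝ} (hg : ∑ b, π b * g b = 0) (a : α) :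
    potential P g a = g a + ∑' k : ℕ, ∑ b, (P ^ (k + 1)) a b * g b := by
  rw [potential, (h.summable_pow_mul hg a).tsum_eq_zero_add]
  simp [Matrix.one_apply]

theorem poisson (h : IsSummablyErgodic P π) {g : α → ℝ} (hg : ∑ b, π b * g b = 0) (a : α) :
    potential P g a = g a + ∑ b, P a b * potential P g b := by
  rw [h.potential_eq hg]
  congr 1
  simp_rw [potential, ← tsum_mul_left]
  rw [← Summable.tsum_finsetSum fun b _ => (h.summable_pow_mul hg b).mul_left _]
  simp_rw [sum_mul_sum_pow_succ]

theorem sum_mul_sum_mul_eq [Nonempty α] (h : IsSummablyErgodic P π) (u : α → ℝ) :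
    ∑ a, π a * ∑ b, P a b * u b = ∑ b, π b * u b := by
  simp_rw [Finset.mul_sum]
  rw [Finset.sum_comm]
  simp_rw [← mul_assoc, ← Finset.sum_mul, h.sum_mul_eq]

/-- The stationary second moment of the martingale increment `u(Z_{t+1}) - (P u)(Z_t)`, with `u` the
potential of `g`, is the sum of the stationary autocovariances of `g`. By invariance of `π` it
equals `π(u² - (P u)²) = π(g (2 u - g))`. -/
theorem variance_martingale_step [Nonempty α] (h : IsSummablyErgodic P π) {g : α → ℝ}
    (hg : ∑ b, π b * g b = 0) :
    ∑ a, π a * ∑ b, P a b * (potential P g b - ∑ c, P a c * potential P g c) ^ 2 =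
      ∑ a, π a * g a ^ 2 + 2 * ∑' k : ℕ, ∑ a, π a * g a * ∑ b, (P ^ (k + 1)) a b * g b := by
  set u := potential P g with hu
  have h1 : ∀ a, ∑ b, P a b * (u b - ∑ c, P a c * u c) ^ 2 =
      ∑ b, P a b * u b ^ 2 - (u a - g a) ^ 2 := fun a => by
    have h2 : ∑ c, P a c * u c = u a - g a := by
      rw [hu, h.poisson hg a]; ring
    rw [h2]
    have h3 : ∀ b, P a b * (u b - (u a - g a)) ^ 2 =
        P a b * u b ^ 2 - 2 * (u a - g a) * (P a b * u b) + P a b * (u a - g a) ^ 2 :=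
      fun b => by ring
    simp_rw [h3]
    rw [Finset.sum_add_distrib, Finset.sum_sub_distrib, ← Finset.mul_sum, ← Finset.sum_mul,
      h.row_sum, h2]
    ring
  simp_rw [h1, mul_sub]
  rw [Finset.sum_sub_distrib, h.sum_mul_sum_mul_eq (fun b => u b ^ 2), ← Finset.sum_sub_distrib]
  have h4 : ∀ a, π a * u a ^ 2 - π a * (u a - g a) ^ 2 = π a * g a ^ 2 +
      2 * ∑' k : ℕ, π a * g a * ∑ b, (P ^ (k + 1)) a b * g b := fun a => by
    rw [tsum_mul_left, hu, h.potential_eq hg]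
    ring
  simp_rw [h4]
  rw [Finset.sum_add_distrib, ← Finset.mul_sum, Summable.tsum_finsetSum]
  exact fun a _ => ((summable_nat_add_iff 1).2 (h.summable_pow_mul hg a)).mul_left _

/-- The Poisson equation splits an additive functional of a path into a sum of martingale increments
and a boundary term that does not grow with `n`. -/
theorem sum_eq_sum_steps_add (h : IsSummablyErgodic P π) {g : α → ℝ}
    (hg : ∑ b, π b * g b = 0) (z : ℕ → α) (n : ℕ) :
    ∑ t ∈ Finset.range n, g (z t) =
      ∑ t ∈ Finset.range n, (potential P g (z (t + 1)) - ∑ c, P (z t) c * potential P g c) +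
        (potential P g (z 0) - potential P g (z n)) := by
  rw [← Finset.sum_range_sub' (fun t => potential P g (z t)), ← Finset.sum_add_distrib]
  refine Finset.sum_congr rfl fun t _ => ?_
  have := h.poisson hg (z t)
  linarith

theorem sum_mul_martingale_step (h : IsSummablyErgodic P π) (u : α → ℝ) (a : α) :
    ∑ b, P a b * (u b - ∑ c, P a c * u c) = 0 := by
  simp_rw [mul_sub]
  rw [Finset.sum_sub_distrib, ← Finset.sum_mul, h.row_sum, one_mul, sub_self]

end IsSummablyErgodic

theorem IsSummablyErgodic.sum_mul_pow_eq {α : Type*} [Fintype α] [DecidableEq α] [Nonempty α]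
    {P : Matrix α α ℝ} {π : α → ℝ} (h : IsSummablyErgodic P π) (k : ℕ) (b : α) :
    ∑ a, π a * (P ^ k) a b = π b := by
  induction k generalizing b with
  | zero => simp [Matrix.one_apply]
  | succ k ih =>
    simp_rw [pow_succ, Matrix.mul_apply, Finset.mul_sum]
    rw [Finset.sum_comm]
    simp_rw [← mul_assoc, ← Finset.sum_mul, ih, h.sum_mul_eq]

theorem IsSummablyErgodic.sum_mul_ite_ne {α : Type*} [Fintype α] [DecidableEq α]
    {P : Matrix α α ℝ} {π : α → ℝ} (h : IsSummablyErgodic P π) (o : α) :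
    ∑ a, π a * (if a = o then (0 : ℝ) else 1) = 1 - π o := by
  have : Nonempty α := ⟨o⟩
  have h1 : ∀ a, π a * (if a = o then (0 : ℝ) else 1) = π a - if a = o then π a else 0 :=
    fun a => by split_ifs <;> ring
  simp_rw [h1]
  rw [Finset.sum_sub_distrib, h.sum_eq_one]
  simp

/-- The boundary term in `IsSummablyErgodic.sum_eq_sum_steps_add` is bounded, hence negligible under
any diverging normalization. -/
theorem tendsto_boundary {α : Type*} [Finite α] (u : α → ℝ) (z : ℕ → α) {r : ℕ → ℝ}
    (hr : Tendsto r atTop atTop) :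
    Tendsto (fun n : ℕ => (u (z 0) - u (z n)) / r n) atTop (𝓝 0) := by
  obtain ⟨B, hB⟩ := Finite.bddAbove_range fun x : α × α => |u x.1 - u x.2|
  refine squeeze_zero_norm' ?_ (tendsto_const_nhds.div_atTop hr : Tendsto (fun n => B / r n) _ _)
  filter_upwards [hr.eventually_gt_atTop 0] with n hn
  rw [Real.norm_eq_abs, abs_div, abs_of_pos hn]
  gcongr
  exact hB ⟨(z 0, z n), rfl⟩

/-! ### Limit theorems for additive functionals -/

namespace IsMarkovChain

variable {Ω α : Type*} [MeasurableSpace Ω] {μ : Measure Ω} [IsProbabilityMeasure μ]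
  [Fintype α] [DecidableEq α] [MeasurableSpace α] [MeasurableSingletonClass α]
  {P : Matrix α α ℝ} {π : α → ℝ} {Z : ℕ → Ω → α}

/-- Strong law of large numbers for a finite Markov chain, from any initial law. -/
theorem ae_tendsto_average (hZ : IsMarkovChain μ P Z) (hP : IsSummablyErgodic P π)
    (f : α → ℝ) :
    ∀ᵐ ω ∂μ, Tendsto (fun n : ℕ => (∑ t ∈ Finset.range n, f (Z t ω)) / (n : ℝ)) atTop
      (𝓝 (∑ a, π a * f a)) := by
  have : Nonempty Ω := nonempty_of_isProbabilityMeasure μ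
  have : Nonempty α := this.map (Z 0)
  set m := ∑ a, π a * f a with hm
  have hg : ∑ b, π b * (f b - m) = 0 := by
    simp_rw [mul_sub]
    rw [Finset.sum_sub_distrib, ← Finset.sum_mul, hP.sum_eq_one, one_mul, sub_self]
  set u := potential P (fun b => f b - m) with hu
  filter_upwards [hZ.ae_tendsto_sum_steps_div (ψ := fun a b => u b - ∑ c, P a c * u c)
    (hP.sum_mul_martingale_step u)] with ω hω
  have h1 := (hω.add (tendsto_boundary u (fun t => Z t ω) tendsto_natCast_atTop_atTop)).add_const m
  rw [add_zero, zero_add] at h1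
  refine h1.congr' ?_
  filter_upwards [eventually_gt_atTop 0] with n hn
  have h2 := hP.sum_eq_sum_steps_add hg (fun t => Z t ω) n
  rw [Finset.sum_sub_distrib, Finset.sum_const, Finset.card_range, nsmul_eq_mul] at h2
  have hn' : (n : ℝ) ≠ 0 := by positivity
  rw [← add_div, ← h2, div_add' _ _ _ hn']
  congr 1
  ring

/-- Central limit theorem for a finite Markov chain, from any initial law, with the variance given
by the stationary autocovariances of the centred function `g`. -/
theorem hasTemporalVariance (hZ : IsMarkovChain μ P Z) (hP : IsSummablyErgodic P π)
    (f g : α → ℝ) (hfg : ∀ a, g a = f a - ∑ b, π b * f b) :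
    HasTemporalVariance μ (fun t ω => f (Z t ω)) (∑ a, π a * g a ^ 2 +
      2 * ∑' k : ℕ, ∑ a, π a * g a * ∑ b, (P ^ (k + 1)) a b * g b) := by
  have : Nonempty Ω := nonempty_of_isProbabilityMeasure μ
  have : Nonempty α := this.map (Z 0)
  set m := ∑ a, π a * f a with hm
  have hg : ∑ b, π b * g b = 0 := by
    simp_rw [hfg, mul_sub]
    rw [Finset.sum_sub_distrib, ← Finset.sum_mul, hP.sum_eq_one, one_mul, sub_self]
  rw [← hP.variance_martingale_step hg]
  set u := potential P g with hu
  set ψ : α → α → ℝ := fun a b => u b - ∑ c, P a c * u c with hψ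
  have hψ0 : ∀ a, ∑ b, P a b * ψ a b = 0 := hP.sum_mul_martingale_step u
  set w : α → ℝ := fun a => ∑ b, P a b * ψ a b ^ 2 with hw
  have hψ2 : ∀ a, ∑ b, P a b * (ψ a b ^ 2 - w a) = 0 := fun a => by
    simp_rw [mul_sub]
    rw [Finset.sum_sub_distrib, ← Finset.sum_mul, hP.row_sum, one_mul, sub_self]
  change HasTemporalVariance μ _ (∑ a, π a * w a)
  set v := ∑ a, π a * w a with hv
  -- `ψ²` differs from its conditional mean `w` by a martingale increment, and the averages of
  -- `w` converge by the strong law.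
  have hsq : ∀ᵐ ω ∂μ, Tendsto (fun n : ℕ =>
      (∑ t ∈ Finset.range n, ψ (Z t ω) (Z (t + 1) ω) ^ 2) / (n : ℝ)) atTop (𝓝 v) := by
    filter_upwards [hZ.ae_tendsto_sum_steps_div (ψ := fun a b => ψ a b ^ 2 - w a) hψ2,
      hZ.ae_tendsto_average hP w] with ω h1 h2
    have h3 := h1.add h2
    rw [zero_add] at h3
    refine h3.congr fun n => ?_
    rw [← add_div, ← Finset.sum_add_distrib]
    simp
  have hv0 : 0 ≤ v := by
    obtain ⟨ω, hω⟩ := hsq.exists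
    exact ge_of_tendsto' hω fun n => by positivity
  obtain ⟨B, hB⟩ := Finite.bddAbove_range fun x : α × α => |ψ x.1 x.2|
  obtain ⟨s, hs⟩ : ∃ s : ℝ≥0, (s : ℝ) = v := ⟨⟨v, hv0⟩, rfl⟩
  rw [← hs] at hsq ⊢
  have hclt := tendstoInDistribution_gaussian_of_integral_prod_eq_one (v := s)
    (D := fun t ω => ψ (Z t ω) (Z (t + 1) ω)) (hZ.measurable_step ψ)
    (fun t ω => hB ⟨(Z t ω, Z (t + 1) ω), rfl⟩) (hZ.integral_prod_steps hψ0) hsq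
  refine ⟨m, hZ.ae_tendsto_average hP f, s, ?_, ?_⟩
  · have hmeas : ∀ n : ℕ, Measurable fun ω =>
        (∑ t ∈ Finset.range n, f (Z t ω) - (n : ℝ) * m) / √(n : ℝ) := fun n =>
      ((Finset.measurable_fun_sum _ fun t _ =>
        (measurable_of_finite f).comp (hZ.measurable t)).sub_const _).div_const _
    refine tendstoInDistribution_of_tendstoInMeasure_sub _ _ hclt ?_
      fun n => (hmeas n).aemeasurable
    have hdiff : ∀ (n : ℕ) ω, (∑ t ∈ Finset.range n, f (Z t ω) - (n : ℝ) * m) / √(n : ℝ) -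
        (∑ t ∈ Finset.range n, ψ (Z t ω) (Z (t + 1) ω)) / √(n : ℝ) =
        (u (Z 0 ω) - u (Z n ω)) / √(n : ℝ) := fun n ω => by
      have h2 := hP.sum_eq_sum_steps_add hg (fun t => Z t ω) n
      simp_rw [hfg] at h2
      rw [Finset.sum_sub_distrib, Finset.sum_const, Finset.card_range, nsmul_eq_mul] at h2
      rw [h2, ← sub_div]
      congr 1
      simp only [hψ, hu]
      ring_nf
    refine tendstoInMeasure_of_tendsto_ae
      (fun n => ((hmeas n).aestronglyMeasurable.sub
        (hclt.forall_aemeasurable n).aestronglyMeasurable))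
      (ae_of_all _ fun ω => ?_)
    simp only [Pi.sub_apply, Pi.zero_apply, hdiff]
    exact tendsto_boundary u (fun t => Z t ω)
      (Real.tendsto_sqrt_atTop.comp tendsto_natCast_atTop_atTop)
  · have h1 := variance_id_gaussianReal (μ := 0) (v := s)
    rw [variance_eq_integral aemeasurable_id] at h1
    simp only [id, integral_id_gaussianReal, sub_zero] at h1
    exact h1

end IsMarkovChain

/-! ### Occupation of a single state -/

namespace IsMarkovChain

variable {Ω α : Type*} [MeasurableSpace Ω] {μ : Measure Ω} [IsProbabilityMeasure μ]
  [Fintype α] [DecidableEq α] [MeasurableSpace α] [MeasurableSingletonClass α]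
  {P : Matrix α α ℝ} {π : α → ℝ} {Z : ℕ → Ω → α}

theorem hasTemporalMean_ne (hZ : IsMarkovChain μ P Z) (hP : IsSummablyErgodic P π) (o : α) :
    HasTemporalMean μ (fun t ω => if Z t ω = o then 0 else 1) (1 - π o) := by
  have h := hZ.ae_tendsto_average hP fun a => if a = o then 0 else 1
  rwa [hP.sum_mul_ite_ne] at h

/-- For the indicator that the chain is not in the state `o`, the autocovariance at lag `k` is
`π(o) (Pᵏ(o, o) - π(o))`. -/
theorem hasTemporalVariance_ne (hZ : IsMarkovChain μ P Z) (hP : IsSummablyErgodic P π) (o : α) :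
    HasTemporalVariance μ (fun t ω => if Z t ω = o then 0 else 1)
      (2 * ∑' k : ℕ, ((P ^ (k + 1)) o o - π o) * π o + π o - π o ^ 2) := by
  have : Nonempty α := ⟨o⟩
  have hsum : ∀ p w : α → ℝ,
      ∑ a, p a * ((π o - if a = o then 1 else 0) * w a) = π o * ∑ a, p a * w a - p o * w o := by
    intro p w
    have h2 : ∀ a, p a * ((π o - if a = o then 1 else 0) * w a) =
        π o * (p a * w a) - if a = o then p a * w a else 0 := fun a => by split_ifs <;> ring
    simp_rw [h2]
    rw [Finset.sum_sub_distrib, ← Finset.mul_sum]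
    simp
  have h := hZ.hasTemporalVariance hP (fun a => if a = o then 0 else 1)
    (fun a => π o - if a = o then 1 else 0) fun a => by
      rw [hP.sum_mul_ite_ne]; split_ifs <;> ring
  have hw : ∀ k a, ∑ b, (P ^ k) a b * (π o - if b = o then 1 else 0) = π o - (P ^ k) a o :=
    fun k a => by
      have := hsum ((P ^ k) a) fun _ => 1
      simp only [mul_one] at this
      rw [this, hP.row_sum_pow, mul_one]
  have h0 : ∀ k, ∑ a, π a * (π o - (P ^ k) a o) = 0 := fun k => by
    simp_rw [mul_sub]
    rw [Finset.sum_sub_distrib, ← Finset.sum_mul, hP.sum_eq_one, hP.sum_mul_pow_eq, one_mul,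
      sub_self]
  have h1 : ∀ k : ℕ, ∑ a, π a * (π o - if a = o then 1 else 0) *
      ∑ b, (P ^ (k + 1)) a b * (π o - if b = o then 1 else 0) =
      ((P ^ (k + 1)) o o - π o) * π o := fun k => by
    simp_rw [hw, mul_assoc]
    rw [hsum π, h0]
    ring
  have h2 : ∑ a, π a * (π o - if a = o then 1 else 0) ^ 2 = π o - π o ^ 2 := by
    simp_rw [pow_two]
    rw [hsum π]
    have h3 := h0 0
    simp only [pow_zero, Matrix.one_apply] at h3
    rw [h3]
    simp
    ring
  simp_rw [h1] at h
  rw [h2] at h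
  convert h using 1
  ring

end IsMarkovChain

/-! ### Products of chains -/

/-- Independent Markov chains, run in parallel, form a Markov chain on the product space. -/
theorem IsMarkovChain.pi {Ω α ι : Type*} [MeasurableSpace Ω] {μ : Measure Ω} [Fintype ι]
    [MeasurableSpace α] [MeasurableSingletonClass α] {P : ι → α → α → ℝ} {C : ι → ℕ → Ω → α}
    (hC : ∀ i, IsMarkovChain μ (P i) (C i))
    (hindep : iIndepFun (fun (i : ι) (ω : Ω) (t : ℕ) => C i t ω) μ) :
    IsMarkovChain μ (fun a b : ι → α => ∏ i, P i (a i) (b i)) (fun t ω i => C i t ω) where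
  measurable t := measurable_pi_lambda _ fun i => (hC i).measurable t
  step t a := by
    have hset : ∀ (n : ℕ) (i : ι), MeasurableSet {z : ℕ → α | ∀ s ≤ n, z s = a s i} := fun n i => by
      simp only [Set.ofPred_forall]
      exact MeasurableSet.iInter fun s => MeasurableSet.iInter fun _ =>
        measurable_pi_apply s (measurableSet_singleton _)
    have key : ∀ n : ℕ, μ.real {ω | ∀ s ≤ n, (fun i => C i s ω) = a s} =
        ∏ i, μ.real {ω | ∀ s ≤ n, C i s ω = a s i} := fun n => by
      have h1 := hindep.measure_inter_preimage_eq_mul Finset.univ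
        (sets := fun i => {z : ℕ → α | ∀ s ≤ n, z s = a s i}) fun i _ => hset n i
      have h2 : {ω | ∀ s ≤ n, (fun i => C i s ω) = a s} = ⋂ i ∈ (Finset.univ : Finset ι),
          (fun ω t => C i t ω) ⁻¹' {z : ℕ → α | ∀ s ≤ n, z s = a s i} := by
        ext ω
        simp only [funext_iff, Set.mem_ofPred_eq, Finset.mem_univ, Set.iInter_true, Set.mem_iInter,
          Set.mem_preimage]
        exact ⟨fun h i s hs => h s hs i, fun h s hs i => h i s hs⟩
      rw [measureReal_def, h2, h1, ENNReal.toReal_prod]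
      rfl
    rw [key, key, ← Finset.prod_mul_distrib]
    exact Finset.prod_congr rfl fun i _ => (hC i).step t fun s => a s i

/-- The transition matrix of independent chains with matrices `P i` run in parallel. -/
def piTransition {ι α : Type*} [Fintype ι] (P : ι → Matrix α α ℝ) :
    Matrix (ι → α) (ι → α) ℝ :=
  Matrix.of fun a b => ∏ i, P i (a i) (b i)

theorem piTransition_pow_apply {ι α : Type*} [Fintype ι] [DecidableEq ι] [Fintype α]
    [DecidableEq α] (P : ι → Matrix α α ℝ) (k : ℕ) (a b : ι → α) :
    (piTransition P ^ k) a b = ∏ i, (P i ^ k) (a i) (b i) := by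
  induction k generalizing b with
  | zero =>
    simp only [pow_zero, Matrix.one_apply, Finset.prod_ite_zero, Finset.prod_const_one,
      funext_iff, Finset.mem_univ, true_imp_iff]
  | succ k ih =>
    simp_rw [pow_succ, Matrix.mul_apply]
    rw [Finset.prod_univ_sum, Fintype.piFinset_univ]
    refine Finset.sum_congr rfl fun c _ => ?_
    rw [ih, Finset.prod_mul_distrib]
    rfl

theorem summable_prod_sub_prod {ι : Type*} (s : Finset ι) {x : ι → ℕ → ℝ} {c : ι → ℝ}
    (hx : ∀ i ∈ s, Summable fun k => x i k - c i) :
    Summable fun k => ∏ i ∈ s, x i k - ∏ i ∈ s, c i := by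
  classical
  induction s using Finset.induction_on with
  | empty => simp
  | insert j s hj ih =>
    have h1 := hx j (Finset.mem_insert_self j s)
    have h2 := ih fun i hi => hx i (Finset.mem_insert_of_mem hi)
    have h3 : Summable fun k => (x j k - c j) * (∏ i ∈ s, x i k - ∏ i ∈ s, c i) :=
      h1.norm.mul_tendsto_const h2.tendsto_cofinite_zero
    refine ((h3.add (h1.mul_right (∏ i ∈ s, c i))).add (h2.mul_left (c j))).congr fun k => ?_
    rw [Finset.prod_insert hj, Finset.prod_insert hj]
    ring

theorem IsSummablyErgodic.pi {ι α : Type*} [Fintype ι] [DecidableEq ι] [Fintype α]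
    [DecidableEq α] {P : ι → Matrix α α ℝ} {π : ι → α → ℝ}
    (h : ∀ i, IsSummablyErgodic (P i) (π i)) :
    IsSummablyErgodic (piTransition P) fun a => ∏ i, π i (a i) where
  row_sum a := by
    have h1 := Finset.prod_univ_sum (fun _ : ι => (Finset.univ : Finset α))
      fun i b => P i (a i) b
    simp_rw [(h _).row_sum, Finset.prod_const_one, Fintype.piFinset_univ] at h1
    exact h1.symm
  summable a b := by
    simp_rw [piTransition_pow_apply]
    exact summable_prod_sub_prod Finset.univ fun i _ => (h i).summable (a i) (b i)

/-! ### Gilbert-Elliott channels -/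

/-- The stationary law of a Gilbert-Elliott channel. -/
noncomputable def gilbertElliottStationary (p q : ℝ) : Bool → ℝ
  | true => q / (p + q)
  | false => p / (p + q)

/-- The second eigenvalue of the transition matrix is `1 - p - q`. -/
theorem gilbertElliott_pow_apply {p q : ℝ} (hpq : p + q ≠ 0) (k : ℕ) (a b : Bool) :
    ((Matrix.of (gilbertElliott p q)) ^ k) a b = gilbertElliottStationary p q b +
      ((if a = b then 1 else 0) - gilbertElliottStationary p q b) * (1 - p - q) ^ k := by
  induction k generalizing b with
  | zero => simp [Matrix.one_apply]
  | succ k ih =>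
    rw [pow_succ, Matrix.mul_apply, Fintype.sum_bool, ih, ih]
    cases a <;> cases b <;>
      simp [gilbertElliott, gilbertElliottStationary] <;> field_simp <;> ring

theorem isSummablyErgodic_gilbertElliott {p q : ℝ} (hpos : 0 < p + q) (hlt : p + q < 2) :
    IsSummablyErgodic (Matrix.of (gilbertElliott p q)) (gilbertElliottStationary p q) where
  row_sum a := by cases a <;> simp [gilbertElliott]
  summable a b := by
    simp_rw [gilbertElliott_pow_apply hpos.ne', add_sub_cancel_left]
    refine (summable_geometric_of_abs_lt_one ?_).mul_left _
    rw [abs_lt]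
    constructor <;> linarith

/-- `geG p q (k + 1)` is the probability that a channel which is OFF is OFF again `k` slots later. -/
theorem gilbertElliott_pow_off {p q : ℝ} (hpq : p + q ≠ 0) (k : ℕ) :
    ((Matrix.of (gilbertElliott p q)) ^ k) false false = geG p q (k + 1) := by
  rw [gilbertElliott_pow_apply hpq, geG]
  simp only [gilbertElliottStationary, if_true, Nat.add_sub_cancel]
  congr 2
  field_simp
  ring

theorem onIndicator_eq {Ω ι : Type*} (C : ι → ℕ → Ω → Bool) (S : Finset ι) (t : ℕ) (ω : Ω)
    [Decidable ((fun i : S => C i t ω) = fun _ => false)] :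
    onIndicator C S t ω = if (fun i : S => C i t ω) = fun _ => false then 0 else 1 := by
  rw [onIndicator]
  have hle : (S.sup fun i => (C i t ω).toNat) ≤ 1 :=
    Finset.sup_le fun i _ => Bool.toNat_le _
  split_ifs with h
  · have h0 : (S.sup fun i => (C i t ω).toNat) = 0 := by
      rw [← bot_eq_zero, Finset.sup_eq_bot_iff]
      intro i hi
      have := congrFun h ⟨i, hi⟩
      simp only at this
      simp [this]
    rw [h0, Nat.cast_zero]
  · obtain ⟨⟨i, hi⟩, hne⟩ := Function.ne_iff.1 h
    have h1 : (C i t ω).toNat ≤ S.sup fun i => (C i t ω).toNat :=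
      Finset.le_sup (f := fun i => (C i t ω).toNat) hi
    have h2 : C i t ω = true := by simpa using hne
    rw [h2] at h1
    rw [le_antisymm hle h1, Nat.cast_one]

/-- The mean and the temporal variance of `X_S` for independent Gilbert-Elliott channels.
The summation index `k : ℕ` below stands for the index `k + 1 ≥ 1` of the series. -/
theorem theorem1 {Ω : Type*} [MeasurableSpace Ω] (μ : Measure Ω) [IsProbabilityMeasure μ]
    (N : ℕ) (p q : Fin N → ℝ)
    (hp0 : ∀ i, 0 ≤ p i) (hp1 : ∀ i, p i ≤ 1) (hq0 : ∀ i, 0 ≤ q i) (hq1 : ∀ i, q i ≤ 1)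
    (hpos : ∀ i, 0 < p i + q i) (hlt : ∀ i, p i + q i < 2)
    (C : Fin N → ℕ → Ω → Bool)
    (hC : ∀ i, IsMarkovChain μ (gilbertElliott (p i) (q i)) (C i))
    (hindep : iIndepFun (fun (i : Fin N) (ω : Ω) (t : ℕ) => C i t ω) μ)
    (S : Finset (Fin N)) :
    HasTemporalMean μ (onIndicator C S) (1 - ∏ i ∈ S, p i / (p i + q i)) ∧
    Summable (fun k : ℕ =>
      (∏ i ∈ S, geG (p i) (q i) ((k + 1) + 1)) - ∏ i ∈ S, p i / (p i + q i)) ∧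
    HasTemporalVariance μ (onIndicator C S)
      (2 * (∑' k : ℕ, ((∏ i ∈ S, geG (p i) (q i) ((k + 1) + 1)) - ∏ i ∈ S, p i / (p i + q i)) *
          ∏ i ∈ S, p i / (p i + q i)) +
        (∏ i ∈ S, p i / (p i + q i)) - (∏ i ∈ S, p i / (p i + q i)) ^ 2) := by
  set Q := piTransition fun i : S => Matrix.of (gilbertElliott (p i) (q i)) with hQ
  set π : (S → Bool) → ℝ := fun a => ∏ i : S, gilbertElliottStationary (p i) (q i) (a i) with hπ
  have hZ : IsMarkovChain μ Q fun t ω (i : S) => C i t ω :=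
    IsMarkovChain.pi (fun i : S => hC i) (hindep.precomp Subtype.val_injective)
  have hE : IsSummablyErgodic Q π :=
    IsSummablyErgodic.pi fun i : S => isSummablyErgodic_gilbertElliott (hpos i) (hlt i)
  have hπo : π (fun _ => false) = ∏ i ∈ S, p i / (p i + q i) :=
    Finset.prod_coe_sort S fun i => p i / (p i + q i)
  have hQo : ∀ k : ℕ, (Q ^ k) (fun _ => false) (fun _ => false) =
      ∏ i ∈ S, geG (p i) (q i) (k + 1) := fun k => by
    rw [hQ, piTransition_pow_apply, ← Finset.prod_coe_sort S fun i => geG (p i) (q i) (k + 1)]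
    exact Finset.prod_congr rfl fun i _ => gilbertElliott_pow_off (hpos i).ne' k
  have hX : onIndicator C S =
      fun t ω => if (fun i : S => C i t ω) = fun _ => false then 0 else 1 := by
    funext t ω
    exact onIndicator_eq C S t ω
  rw [hX, ← hπo]
  simp_rw [← hQo]
  -- Opaque `Q` and `π` keep the unifier from unfolding the products over channels.
  clear_value Q π
  exact ⟨hZ.hasTemporalMean_ne hE _, (summable_nat_add_iff 1).2 (hE.summable _ _),
    hZ.hasTemporalVariance_ne hE _⟩
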